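/- Let $L^2$ be the Lebesgue space of the unit circle $\mathbb{T}$ with normalized Lebesgue measure, let $H^2\subset L^2$ be the Hardy space of functions whose Fourier coefficients of negative index vanish, let $u$ be a nonconstant inner function (i.e. $u\in H^2$, $|u|=1$ a.e. on $\mathbb{T}$, $u$ not constant), let $K_u = H^2\ominus uH^2$, and let $P_u$ be the orthogonal projection of $L^2$ onto $K_u$. A bounded linear operator $A$ on $K_u$ is a bounded truncated Toeplitz operator (TTO) with symbol $\Phi\in L^2$ if $Af=P_u(\Phi f)$ for every bounded function $f\in K_u$; symbols are not unique. Write $S_u f = P_u(zf)$ for the compressed shift on $K_u$ and $Cf = u\,\overline{zf}$ for the conjugation on $K_u$. For $\alpha\in\mathbb{C}$, a bounded TTO is of type $\alpha$ if it has a symbol of the form $\varphi+\alpha\,\overline{S_uC\varphi}+c$ with $\varphi\in K_u$ and $c\in\mathbb{C}$; it is of type $\infty$ if it has an antiholomorphic symbol, i.e. a symbol $\Phi$ with $\overline{\Phi}\in H^2$. **Theorem.** Let $A$ be a bounded TTO on $K_u$ that is invertible as a bounded operator on $K_u$. Then $A^{-1}$ is a TTO if and only if $A$ is of type $\alpha$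 for some $\alpha\in\mathbb{C}\cup\{\infty\}$. Moreover, if $A^{-1}$ is a TTO, then $A$ and $A^{-1}$ are of the same type: for every $\alpha\in\mathbb{C}\cup\{\infty\}$, $A$ is of type $\alpha$ if and only if $A^{-1}$ is of type $\alpha$. -/

import Mathlib

noncomputable section

open MeasureTheory AddCircle
open scoped ComplexConjugate

namespace TTO

/-- Normalized Lebesgue measure on the unit circle, the circle being parametrized by
`x ↦ exp (2 π i x)`, `x ∈ ℝ / ℤ`. -/
abbrev circleMeasure : Measure UnitAddCircle := haarAddCircle

/-- The space `L²` of the unit circle. -/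
abbrev L2 : Type := Lp ℂ 2 circleMeasure

/-- The coordinate function `z` on the unit circle. -/
abbrev zfun (x : UnitAddCircle) : ℂ := fourier 1 x

/-- The Hardy space `H²`: the functions in `L²` all of whose Fourier coefficients of negative
index vanish. -/
def hardy : Submodule ℂ L2 where
  carrier := {f | ∀ n : ℤ, n < 0 → fourierCoeff f n = 0}
  zero_mem' := by
    intro n _
    rw [← fourierBasis_repr]
    simp
  add_mem' := by
    intro f g hf hg n hn
    have h1 := hf n hn
    have h2 := hg n hn
    rw [← fourierBasis_repr] at h1 h2 ⊢
    simp [h1, h2]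
  smul_mem' := by
    intro c f hf n hn
    have h1 := hf n hn
    rw [← fourierBasis_repr] at h1 ⊢
    simp [h1]

theorem mem_hardy {f : L2} : f ∈ hardy ↔ ∀ n : ℤ, n < 0 → fourierCoeff f n = 0 := Iff.rfl

/-- A nonconstant inner function, given by its boundary values: an element of `H²` that is
unimodular almost everywhere on the circle and is not constant. -/
structure InnerFunction where
  /-- the boundary function -/
  toLp : L2
  mem_hardy : toLp ∈ hardy
  norm_eq_one : ∀ᵐ x ∂circleMeasure, ‖toLp x‖ = 1
  nonconstant : ∀ c : ℂ, ¬ (∀ᵐ x ∂circleMeasure, toLp x = c)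

/-- The subspace `u H²` of `L²`. -/
def mulHardy (u : InnerFunction) : Submodule ℂ L2 where
  carrier := {f | ∃ h ∈ hardy, ∀ᵐ x ∂circleMeasure, f x = u.toLp x * h x}
  zero_mem' := by
    refine ⟨0, hardy.zero_mem, ?_⟩
    filter_upwards [Lp.coeFn_zero ℂ 2 circleMeasure] with x hx
    rw [hx]
    simp
  add_mem' := by
    rintro f g ⟨h, hh, hf⟩ ⟨k, hk, hg⟩
    refine ⟨h + k, hardy.add_mem hh hk, ?_⟩
    filter_upwards [hf, hg, Lp.coeFn_add f g, Lp.coeFn_add h k] with x h1 h2 h3 h4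
    simp only [h3, h4, Pi.add_apply, h1, h2]
    ring
  smul_mem' := by
    rintro c f ⟨h, hh, hf⟩
    refine ⟨c • h, hardy.smul_mem c hh, ?_⟩
    filter_upwards [hf, Lp.coeFn_smul c f, Lp.coeFn_smul c h] with x h1 h2 h3
    simp only [h2, h3, Pi.smul_apply, h1, smul_eq_mul]
    ring

/-- The model space `K_u = H² ⊖ u H²`. -/
def modelSpace (u : InnerFunction) : Submodule ℂ L2 := hardy ⊓ (mulHardy u)ᗮ

theorem isClosed_hardy : IsClosed (hardy : Set L2) := by
  have : (hardy : Set L2) =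
      ⋂ n : ℤ, ⋂ _ : n < 0, {f : L2 | inner ℂ (fourierBasis (T := 1) n) f = 0} := by
    ext f
    simp only [SetLike.mem_coe, mem_hardy, Set.mem_iInter, Set.mem_ofPred_eq,
      ← HilbertBasis.repr_apply_apply, fourierBasis_repr]
  rw [this]
  refine isClosed_iInter fun n => isClosed_iInter fun _ => ?_
  exact isClosed_eq (by fun_prop) continuous_const

instance completeSpace_modelSpace (u : InnerFunction) : CompleteSpace (modelSpace u) := by
  have : IsClosed (modelSpace u : Set L2) :=
    isClosed_hardy.inter (Submodule.isClosed_orthogonal _)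
  exact this.completeSpace_coe

/-- The orthogonal projection `P_u` of `L²` onto the model space. -/
def proj (u : InnerFunction) : L2 →L[ℂ] modelSpace u := (modelSpace u).orthogonalProjectionOnto

/-- The product `Φ f ∈ L²` of `Φ ∈ L²` and a bounded function `f`. -/
def mulBdd (Φ : L2) (f : UnitAddCircle → ℂ) (hf : MemLp f ⊤ circleMeasure) : L2 :=
  MemLp.toLp (fun x => f x * Φ x) ((Lp.memLp Φ).mul' hf)

theorem mulBdd_ae (Φ : L2) (f : UnitAddCircle → ℂ) (hf : MemLp f ⊤ circleMeasure) :
    ∀ᵐ x ∂circleMeasure, mulBdd Φ f hf x = f x * Φ x :=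
  MemLp.coeFn_toLp ((Lp.memLp Φ).mul' hf)

theorem memLp_zfun : MemLp zfun ⊤ circleMeasure := by
  refine memLp_top_of_bound (fourier 1).continuous.aestronglyMeasurable 1 (Filter.Eventually.of_forall fun x => ?_)
  exact (Circle.norm_coe _).le

theorem memLp_inner (u : InnerFunction) : MemLp u.toLp ⊤ circleMeasure :=
  memLp_top_of_bound (Lp.aestronglyMeasurable _) 1 (u.norm_eq_one.mono fun _ h => h.le)

/-- The conjugation `C f = u * conj (z f)` on `L²`. -/
def conjL2 (u : InnerFunction) (f : L2) : L2 :=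
  mulBdd (star (mulBdd f zfun memLp_zfun)) u.toLp (memLp_inner u)

theorem conjL2_ae (u : InnerFunction) (f : L2) :
    ∀ᵐ x ∂circleMeasure, conjL2 u f x = u.toLp x * conj (zfun x * f x) := by
  have h1 := mulBdd_ae (star (mulBdd f zfun memLp_zfun)) u.toLp (memLp_inner u)
  have h2 := Lp.coeFn_star (mulBdd f zfun memLp_zfun)
  have h3 := mulBdd_ae f zfun memLp_zfun
  filter_upwards [h1, h2, h3] with x h1 h2 h3
  rw [conjL2, h1, h2, Pi.star_apply, h3, RCLike.star_def]

theorem conjL2_mem (u : InnerFunction) {f : L2} (hf : f ∈ modelSpace u) :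
    conjL2 u f ∈ modelSpace u := by
  refine Submodule.mem_inf.2 ⟨fun n hn => ?_, (Submodule.mem_orthogonal _ _).2 ?_⟩
  · have hfo := (Submodule.mem_orthogonal _ _).1 (Submodule.mem_inf.1 hf).2
    obtain ⟨m, rfl⟩ : ∃ m : ℕ, n = -(m + 1 : ℤ) := ⟨(-n - 1).toNat, by omega⟩
    have hmem : mulBdd (fourierLp 2 (m : ℤ)) u.toLp (memLp_inner u) ∈ mulHardy u := by
      refine ⟨fourierLp 2 (m : ℤ), fun k hk => ?_, MemLp.coeFn_toLp _⟩
      rw [← fourierBasis_repr, HilbertBasis.repr_apply_apply, coe_fourierBasis]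
      exact (orthonormal_fourier (T := 1)).2 (by omega)
    have h0 := hfo _ hmem
    rw [L2.inner_def] at h0
    have h1 := congrArg conj h0
    rw [← integral_conj, map_zero] at h1
    rw [fourierCoeff, ← h1]
    refine integral_congr_ae ?_
    have hm := mulBdd_ae (fourierLp 2 (m : ℤ)) u.toLp (memLp_inner u)
    filter_upwards [conjL2_ae u f, hm, coeFn_fourierLp (T := 1) 2 (m : ℤ)] with x hx hm hfm
    rw [hx, hm, hfm]
    simp only [RCLike.inner_apply, smul_eq_mul, map_mul, Complex.conj_conj, zfun, neg_neg,
      fourier_add, ← fourier_neg]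
    have : (fourier (-1) x : ℂ) * fourier 1 x = 1 := by
      rw [← fourier_add]; simp
    linear_combination (fourier (m : ℤ) x * u.toLp x * conj (f x)) * this
  · rintro g ⟨h, hh, hg⟩
    have hsum := (fourierBasis (T := 1)).tsum_inner_mul_inner h (star (mulBdd f zfun memLp_zfun))
    have hz := mulBdd_ae f zfun memLp_zfun
    have hs := Lp.coeFn_star (mulBdd f zfun memLp_zfun)
    have hzero : inner ℂ h (star (mulBdd f zfun memLp_zfun)) = 0 := by
      rw [← hsum]
      refine (tsum_congr fun i => ?_).trans tsum_zero
      rcases lt_or_ge i 0 with hi | hi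
      · have := hh i hi
        rw [← fourierBasis_repr, HilbertBasis.repr_apply_apply] at this
        rw [inner_eq_zero_symm.1 this, zero_mul]
      · have h0 := (Submodule.mem_inf.1 hf).1 (-(i + 1)) (by omega)
        rw [fourierCoeff] at h0
        have h1 := congrArg conj h0
        rw [← integral_conj, map_zero] at h1
        rw [← HilbertBasis.repr_apply_apply, fourierBasis_repr, fourierCoeff]
        refine mul_eq_zero_of_right _ (Eq.trans (integral_congr_ae ?_) h1)
        filter_upwards [hz, hs] with x hz hs
        rw [hs, Pi.star_apply, hz, RCLike.star_def]
        simp only [smul_eq_mul, map_mul, zfun, neg_neg, fourier_add, ← fourier_neg]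
        ring
    rw [L2.inner_def] at hzero ⊢
    rw [← hzero]
    refine integral_congr_ae ?_
    filter_upwards [conjL2_ae u f, hg, hz, hs, u.norm_eq_one] with x hx hg hz hs hu
    rw [hs, Pi.star_apply, hz, RCLike.star_def, hx, hg]
    simp only [RCLike.inner_apply, map_mul]
    have hu' : u.toLp x * conj (u.toLp x) = 1 := by
      rw [Complex.mul_conj, Complex.normSq_eq_norm_sq, hu]; simp
    linear_combination (conj (zfun x) * conj (f x) * conj (h x)) * hu'

/-- The conjugation `C` on the model space. -/
def conjModel (u : InnerFunction) (f : modelSpace u) : modelSpace u :=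
  ⟨conjL2 u f, conjL2_mem u f.2⟩

/-- The compressed shift `S_u f = P_u (z f)` on the model space. -/
def compressedShift (u : InnerFunction) (f : modelSpace u) : modelSpace u :=
  proj u (mulBdd (f : L2) zfun memLp_zfun)

/-- `Φ ∈ L²` is a symbol of the bounded operator `A` on the model space, i.e. `A` is the bounded
extension of the truncated Toeplitz operator `f ↦ P_u (Φ f)`, which is defined on the bounded
functions `f` of the model space. -/
def HasSymbol (u : InnerFunction) (A : modelSpace u →L[ℂ] modelSpace u) (Φ : L2) : Prop :=
  ∀ (f : modelSpace u) (hf : MemLp (f : L2) ⊤ circleMeasure),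
    A f = proj u (mulBdd Φ (f : L2) hf)

/-- `A` is a bounded truncated Toeplitz operator. -/
def IsTTO (u : InnerFunction) (A : modelSpace u →L[ℂ] modelSpace u) : Prop :=
  ∃ Φ : L2, HasSymbol u A Φ

/-- `A` is a bounded truncated Toeplitz operator of type `α`, for `α` in the Riemann sphere
`OnePoint ℂ`: it has a symbol `φ + α * conj (S_u C φ) + c` with `φ ∈ K_u` and `c ∈ ℂ` if `α` is
finite, and an antiholomorphic symbol, i.e. one whose conjugate is in `H²`, if `α = ∞`. -/
def IsOfType (u : InnerFunction) (A : modelSpace u →L[ℂ] modelSpace u) : OnePoint ℂ → Prop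
  | OnePoint.infty => ∃ Φ : L2, star Φ ∈ hardy ∧ HasSymbol u A Φ
  | OnePoint.some α => ∃ (φ : modelSpace u) (c : ℂ),
      HasSymbol u A ((φ : L2) + α • star (compressedShift u (conjModel u φ) : L2)
        + Lp.const 2 circleMeasure c)

end TTO

end

section

open MeasureTheory AddCircle
open scoped ComplexConjugate

namespace TTO

/-! ### Products and Fourier coefficients in `L²` -/

/-! Write `k = P_u 1`, `v` for the conjugate of the mean of `u`, `S = S_u`, and use the symmetric
bilinear form `⟪f, C g⟫`, for which `S` and every TTO are self-transpose. If `A` has symbol `Φ`,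
then `A S - S A` is the antisymmetric operator `k ∧ w` of rank at most two, with `w = P_u (u Φ)`,
and `A k = P_u Φ - v w`. Conversely, since the vectors `Sⁿ k` span a dense subspace, these two data
determine `A` among self-transpose operators (`hasSymbol_of_hasCommutator`); `w` matters only modulo
`k`.

Hence being of a given type is a linear relation `a • A k + b • w ∈ ℂ k`: type `α` is `(a, b) = (α,
α v - 1)` and type `∞` is `(1, v)`. Up to scaling these pairs exhaust the projective line, so having
some type means having some nontrivial relation (`exists_isOfType_iff`).

For `B = A⁻¹` the commutator is `B w ∧ B k`. Applying `B` to a relation gives `a • k + b • B w ∈ ℂ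
(B k)`, which turns this into `k ∧ y` for some `y` satisfying the same relation (`HasRelation.inv`);
so `B` has the same type. Conversely, if `B` is a TTO, then `k ∧ y = B w ∧ B k`, and comparing the
two sides forces a relation (`exists_hasRelation`). -/

theorem mulBdd_add (Φ Ψ : L2) (f : UnitAddCircle → ℂ) (hf : MemLp f ⊤ circleMeasure) :
    mulBdd (Φ + Ψ) f hf = mulBdd Φ f hf + mulBdd Ψ f hf := by
  refine Lp.ext ?_
  filter_upwards [mulBdd_ae (Φ + Ψ) f hf, mulBdd_ae Φ f hf, mulBdd_ae Ψ f hf,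
    Lp.coeFn_add (mulBdd Φ f hf) (mulBdd Ψ f hf), Lp.coeFn_add Φ Ψ] with x h1 h2 h3 h4 h5
  rw [h1, h4, Pi.add_apply, h2, h3, h5, Pi.add_apply, mul_add]

theorem mulBdd_smul (c : ℂ) (Φ : L2) (f : UnitAddCircle → ℂ) (hf : MemLp f ⊤ circleMeasure) :
    mulBdd (c • Φ) f hf = c • mulBdd Φ f hf := by
  refine Lp.ext ?_
  filter_upwards [mulBdd_ae (c • Φ) f hf, mulBdd_ae Φ f hf,
    Lp.coeFn_smul c (mulBdd Φ f hf), Lp.coeFn_smul c Φ] with x h1 h2 h4 h5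
  rw [h1, h4, Pi.smul_apply, h2, h5, Pi.smul_apply, smul_eq_mul, smul_eq_mul]
  ring

/-- Multiplication by a bounded function on `L²`. -/
noncomputable def mulLin (f : UnitAddCircle → ℂ) (hf : MemLp f ⊤ circleMeasure) : L2 →ₗ[ℂ] L2 where
  toFun Φ := mulBdd Φ f hf
  map_add' Φ Ψ := mulBdd_add Φ Ψ f hf
  map_smul' c Φ := mulBdd_smul c Φ f hf

/-- Multiplication by the coordinate function. -/
noncomputable abbrev mulZ : L2 →ₗ[ℂ] L2 := mulLin zfun memLp_zfun

/-- Multiplication by the inner function. -/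
noncomputable abbrev mulU (u : InnerFunction) : L2 →ₗ[ℂ] L2 := mulLin u.toLp (memLp_inner u)

/-- The constant function `1`. -/
noncomputable abbrev one : L2 := Lp.const 2 circleMeasure (1 : ℂ)

theorem one_ae : ∀ᵐ x ∂circleMeasure, one x = 1 := Lp.coeFn_const 2 circleMeasure (1 : ℂ)

theorem const_eq_smul_one (c : ℂ) : Lp.const 2 circleMeasure c = c • one := by
  refine Lp.ext ?_
  filter_upwards [Lp.coeFn_const 2 circleMeasure c, Lp.coeFn_smul c one, one_ae] with x h1 h2 h3
  rw [h1, h2, Pi.smul_apply, h3]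
  simp

theorem mulZ_ae (f : L2) : ∀ᵐ x ∂circleMeasure, mulZ f x = zfun x * f x :=
  mulBdd_ae f zfun memLp_zfun

theorem mulU_ae (u : InnerFunction) (f : L2) :
    ∀ᵐ x ∂circleMeasure, mulU u f x = u.toLp x * f x :=
  mulBdd_ae f u.toLp (memLp_inner u)

theorem star_ae (f : L2) : ∀ᵐ x ∂circleMeasure, (star f : L2) x = conj (f x) := by
  filter_upwards [Lp.coeFn_star f] with x h
  rw [h, Pi.star_apply, RCLike.star_def]

theorem zfun_mul_conj (x : UnitAddCircle) : zfun x * conj (zfun x) = 1 := by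
  rw [zfun, ← fourier_neg, ← fourier_add]; simp

theorem inner_mul_conj (u : InnerFunction) :
    ∀ᵐ x ∂circleMeasure, u.toLp x * conj (u.toLp x) = 1 := by
  filter_upwards [u.norm_eq_one] with x hx
  rw [Complex.mul_conj, Complex.normSq_eq_norm_sq, hx]; simp

theorem fourierCoeff_eq_inner (f : L2) (n : ℤ) :
    fourierCoeff f n = inner ℂ (fourierBasis (T := 1) n) f := by
  rw [← fourierBasis_repr, HilbertBasis.repr_apply_apply]

theorem fourierCoeff_sub (f g : L2) (n : ℤ) :
    fourierCoeff (f - g : L2) n = fourierCoeff f n - fourierCoeff g n := by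
  simp only [fourierCoeff_eq_inner, inner_sub_right]

theorem fourierCoeff_smul (c : ℂ) (f : L2) (n : ℤ) :
    fourierCoeff (c • f : L2) n = c * fourierCoeff f n := by
  simp only [fourierCoeff_eq_inner, inner_smul_right]

theorem fourierCoeff_mulZ (f : L2) (n : ℤ) :
    fourierCoeff (mulZ f) n = fourierCoeff f (n - 1) := by
  refine integral_congr_ae ?_
  filter_upwards [mulZ_ae f] with x h
  have : (-(n - 1) : ℤ) = -n + 1 := by ring
  rw [h, this, fourier_add]
  simp only [smul_eq_mul, zfun]
  ring

theorem fourierCoeff_star (f : L2) (n : ℤ) :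
    fourierCoeff (star f : L2) n = conj (fourierCoeff f (-n)) := by
  rw [fourierCoeff, fourierCoeff, ← integral_conj]
  refine integral_congr_ae ?_
  filter_upwards [star_ae f] with x h
  rw [h, neg_neg]
  simp

theorem one_eq_fourierBasis : one = fourierBasis (T := 1) 0 := by
  refine Lp.ext ?_
  rw [coe_fourierBasis]
  filter_upwards [one_ae, coeFn_fourierLp (T := 1) 2 0] with x h1 h2
  rw [h1, h2]
  simp

theorem fourierCoeff_one (n : ℤ) : fourierCoeff one n = if n = 0 then 1 else 0 := by
  rw [fourierCoeff_eq_inner, one_eq_fourierBasis]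
  exact orthonormal_iff_ite.1 (fourierBasis (T := 1)).orthonormal n 0

theorem one_mem_hardy : one ∈ hardy := fun n hn => by
  rw [fourierCoeff_one, if_neg hn.ne]

theorem mulZ_mem_hardy {f : L2} (hf : f ∈ hardy) : mulZ f ∈ hardy := fun n hn => by
  rw [fourierCoeff_mulZ]
  exact hf _ (by omega)

theorem eq_zero_of_fourierCoeff {f : L2} (h : ∀ n, fourierCoeff f n = 0) : f = 0 := by
  refine (fourierBasis (T := 1)).repr.injective ?_
  ext n
  rw [fourierBasis_repr, h, map_zero]
  rfl

/-- The mean of the product of two functions in `H²` is the product of their means. -/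
theorem inner_star_of_mem_hardy {f g : L2} (hf : f ∈ hardy) (hg : g ∈ hardy) :
    inner ℂ (star f : L2) g = fourierCoeff f 0 * fourierCoeff g 0 := by
  rw [← (fourierBasis (T := 1)).tsum_inner_mul_inner (star f : L2) g, tsum_eq_single 0]
  · rw [← inner_conj_symm, ← fourierCoeff_eq_inner, ← fourierCoeff_eq_inner, fourierCoeff_star]
    simp
  · intro n hn
    rw [← inner_conj_symm, ← fourierCoeff_eq_inner, ← fourierCoeff_eq_inner, fourierCoeff_star]
    rcases lt_or_gt_of_ne hn with h | h
    · rw [hg n h, mul_zero]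
    · rw [hf (-n) (by omega)]
      simp

theorem mulU_mem_mulHardy (u : InnerFunction) {f : L2} (hf : f ∈ hardy) :
    mulU u f ∈ mulHardy u := ⟨f, hf, mulU_ae u f⟩

theorem mulU_one (u : InnerFunction) : mulU u one = u.toLp := by
  refine Lp.ext ?_
  filter_upwards [mulU_ae u one, one_ae] with x h1 h2
  rw [h1, h2, mul_one]

theorem toLp_mem_mulHardy (u : InnerFunction) : u.toLp ∈ mulHardy u := by
  have := mulU_mem_mulHardy u one_mem_hardy
  rwa [mulU_one] at this

/-! ### The bilinear form of the conjugation -/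

/-- The bilinear form `(f, g) ↦ ⟪f, C g⟫` attached to the conjugation `C`. -/
noncomputable def bil (u : InnerFunction) (f g : L2) : ℂ := inner ℂ (conjL2 u g) f

theorem bil_eq_integral (u : InnerFunction) (f g : L2) :
    bil u f g = ∫ x, conj (u.toLp x) * zfun x * f x * g x ∂circleMeasure := by
  rw [bil, L2.inner_def]
  refine integral_congr_ae ?_
  filter_upwards [conjL2_ae u g] with x h
  rw [RCLike.inner_apply, h]
  simp only [map_mul, Complex.conj_conj]
  ring

theorem bil_comm (u : InnerFunction) (f g : L2) : bil u f g = bil u g f := by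
  rw [bil_eq_integral, bil_eq_integral]
  congr 1; ext x; ring

theorem bil_add_left (u : InnerFunction) (f g h : L2) :
    bil u (f + g) h = bil u f h + bil u g h := inner_add_right _ _ _

theorem bil_sub_left (u : InnerFunction) (f g h : L2) :
    bil u (f - g) h = bil u f h - bil u g h := inner_sub_right _ _ _

theorem bil_smul_left (u : InnerFunction) (c : ℂ) (f h : L2) :
    bil u (c • f) h = c * bil u f h := inner_smul_right _ _ _

theorem bil_add_right (u : InnerFunction) (f g h : L2) :
    bil u h (f + g) = bil u h f + bil u h g := by
  simp only [bil_comm u h, bil_add_left]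

theorem bil_sub_right (u : InnerFunction) (f g h : L2) :
    bil u h (f - g) = bil u h f - bil u h g := by
  simp only [bil_comm u h, bil_sub_left]

theorem bil_smul_right (u : InnerFunction) (c : ℂ) (f h : L2) :
    bil u h (c • f) = c * bil u h f := by
  simp only [bil_comm u h, bil_smul_left]

theorem conjL2_conjL2 (u : InnerFunction) (f : L2) : conjL2 u (conjL2 u f) = f := by
  refine Lp.ext ?_
  filter_upwards [conjL2_ae u f, conjL2_ae u (conjL2 u f), inner_mul_conj u] with x h1 h2 h3
  rw [h2, h1]
  simp only [map_mul, Complex.conj_conj]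
  linear_combination (f x * zfun x * conj (zfun x)) * h3 + f x * zfun_mul_conj x

theorem conjL2_sub (u : InnerFunction) (f g : L2) :
    conjL2 u (f - g) = conjL2 u f - conjL2 u g := by
  refine Lp.ext ?_
  filter_upwards [conjL2_ae u f, conjL2_ae u g, conjL2_ae u (f - g), Lp.coeFn_sub f g,
    Lp.coeFn_sub (conjL2 u f) (conjL2 u g)] with x h1 h2 h3 h4 h5
  rw [h3, h5, Pi.sub_apply, h1, h2, h4, Pi.sub_apply]
  simp only [map_mul, map_sub]
  ring

theorem conjL2_smul (u : InnerFunction) (c : ℂ) (f : L2) :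
    conjL2 u (c • f) = conj c • conjL2 u f := by
  refine Lp.ext ?_
  filter_upwards [conjL2_ae u f, conjL2_ae u (c • f), Lp.coeFn_smul c f,
    Lp.coeFn_smul (conj c) (conjL2 u f)] with x h1 h3 h4 h5
  rw [h3, h5, Pi.smul_apply, h1, h4, Pi.smul_apply]
  simp only [map_mul, smul_eq_mul]
  ring

theorem bil_mulZ_left (u : InnerFunction) (f g : L2) :
    bil u (mulZ f) g = bil u f (mulZ g) := by
  rw [bil_eq_integral, bil_eq_integral]
  refine integral_congr_ae ?_
  filter_upwards [mulZ_ae f, mulZ_ae g] with x h1 h2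
  rw [h1, h2]; ring

/-- `⟪u f, C g⟫` is the mean of `z f g`. -/
theorem bil_mulU_left (u : InnerFunction) (f g : L2) :
    bil u (mulU u f) g = inner ℂ (star f : L2) (mulZ g) := by
  rw [bil_eq_integral, L2.inner_def]
  refine integral_congr_ae ?_
  filter_upwards [mulZ_ae g, mulU_ae u f, star_ae f, inner_mul_conj u] with x h1 h2 h3 h4
  rw [RCLike.inner_apply, h1, h2, h3, Complex.conj_conj]
  linear_combination (zfun x * f x * g x) * h4

theorem bil_mulU_of_mem_hardy (u : InnerFunction) {f g : L2} (hf : f ∈ hardy) (hg : g ∈ hardy) :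
    bil u (mulU u f) g = 0 := by
  rw [bil_mulU_left, inner_star_of_mem_hardy hf (mulZ_mem_hardy hg), fourierCoeff_mulZ,
    hg _ (by norm_num), mul_zero]

/-- For `h` in `H²`, `⟪u h, f⟫` is the conjugate of the mean of `z h (C f)`, which vanishes once `C
f` is in `H²`. Membership thus reduces to checking negative Fourier coefficients. -/
theorem mem_modelSpace_iff (u : InnerFunction) (f : L2) :
    f ∈ modelSpace u ↔ f ∈ hardy ∧ conjL2 u f ∈ hardy := by
  refine ⟨fun h => ⟨h.1, (conjL2_mem u h).1⟩, fun h => ⟨h.1, (Submodule.mem_orthogonal _ _).2 ?_⟩⟩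
  rintro g ⟨k, hk, hg⟩
  have : g = mulU u k := Lp.ext (by
    filter_upwards [hg, mulU_ae u k] with x h1 h2
    rw [h1, h2])
  subst this
  have h1 := bil_mulU_of_mem_hardy u hk h.2
  rw [bil, conjL2_conjL2] at h1
  exact inner_eq_zero_symm.1 h1

/-! ### The compressed shift -/

theorem inner_proj (u : InnerFunction) (g : modelSpace u) (h : L2) :
    inner ℂ (g : L2) (proj u h : L2) = inner ℂ (g : L2) h :=
  Submodule.inner_orthogonalProjectionOnto_eq_of_mem_left g h

theorem bil_proj (u : InnerFunction) (h : L2) (g : modelSpace u) :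
    bil u (proj u h) g = bil u h g :=
  inner_proj u (conjModel u g) h

theorem bil_proj_right (u : InnerFunction) (h : L2) (g : modelSpace u) :
    bil u g (proj u h) = bil u g h := by
  rw [bil_comm, bil_proj, bil_comm]

theorem proj_of_mem (u : InnerFunction) (g : modelSpace u) : proj u g = g :=
  Submodule.orthogonalProjectionOnto_mem_subspace_eq_self g

theorem proj_mulHardy (u : InnerFunction) {h : L2} (hh : h ∈ mulHardy u) : proj u h = 0 :=
  Submodule.orthogonalProjectionOnto_eq_zero_iff.2
    ((Submodule.mem_orthogonal' _ _).2 fun _ hg => (Submodule.mem_orthogonal _ _).1 hg.2 _ hh)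

/-- The form is nondegenerate on the model space because `C` is an involution of it. -/
theorem modelSpace_ext (u : InnerFunction) {f g : modelSpace u}
    (h : ∀ k : modelSpace u, bil u f k = bil u g k) : f = g := by
  refine ext_inner_left ℂ fun k => ?_
  have := h (conjModel u k)
  simp only [bil, conjModel, conjL2_conjL2] at this
  exact this

/-- The reproducing kernel at the origin. -/
noncomputable def ker (u : InnerFunction) : modelSpace u := proj u one

theorem fourierCoeff_conjL2_zero (u : InnerFunction) (f : L2) :
    fourierCoeff (conjL2 u f) 0 = conj (bil u f one) := by
  rw [bil_comm, fourierCoeff_eq_inner, ← one_eq_fourierBasis, bil, inner_conj_symm]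

theorem fourierCoeff_conjL2_mulZ (u : InnerFunction) (f : L2) (n : ℤ) :
    fourierCoeff (conjL2 u (mulZ f)) n = fourierCoeff (conjL2 u f) (n + 1) := by
  have key : mulZ (conjL2 u (mulZ f)) = conjL2 u f := by
    refine Lp.ext ?_
    filter_upwards [mulZ_ae (conjL2 u (mulZ f)), conjL2_ae u (mulZ f), mulZ_ae f,
      conjL2_ae u f] with x h1 h2 h3 h4
    rw [h1, h2, h3, h4]
    simp only [map_mul]
    linear_combination (u.toLp x * conj (zfun x) * conj (f x)) * zfun_mul_conj x
  rw [← key, fourierCoeff_mulZ, add_sub_cancel_right]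

theorem bil_ker_right (u : InnerFunction) (f : modelSpace u) :
    bil u f (ker u) = bil u f one := bil_proj_right u one f

theorem one_sub_smul_toLp_mem_modelSpace (u : InnerFunction) :
    one - conj (fourierCoeff u.toLp 0) • u.toLp ∈ modelSpace u := by
  rw [mem_modelSpace_iff]
  refine ⟨hardy.sub_mem one_mem_hardy (hardy.smul_mem _ u.mem_hardy), fun n hn => ?_⟩
  -- Multiplying by `z` shifts indices by one, so the coefficient of index `-1` becomes the mean of
  -- `u` minus its own mean, which is zero.
  have key : mulZ (conjL2 u (one - conj (fourierCoeff u.toLp 0) • u.toLp)) =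
      u.toLp - fourierCoeff u.toLp 0 • one := by
    rw [conjL2_sub, conjL2_smul, Complex.conj_conj]
    refine Lp.ext ?_
    set c := fourierCoeff u.toLp 0
    filter_upwards [mulZ_ae (conjL2 u one - c • conjL2 u u.toLp),
      Lp.coeFn_sub (conjL2 u one) (c • conjL2 u u.toLp), Lp.coeFn_smul c (conjL2 u u.toLp),
      conjL2_ae u one, conjL2_ae u u.toLp, Lp.coeFn_sub u.toLp (c • one), Lp.coeFn_smul c one,
      one_ae, inner_mul_conj u] with x h1 h2 h3 h4 h5 h6 h7 h8 h9
    rw [h1, h2, Pi.sub_apply, h3, Pi.smul_apply, h4, h5, h6, Pi.sub_apply, h7, Pi.smul_apply, h8]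
    simp only [map_mul, map_one, smul_eq_mul]
    linear_combination (u.toLp x - c * u.toLp x * conj (u.toLp x)) * zfun_mul_conj x - c * h9
  have h0 := congrArg (fun f : L2 => fourierCoeff f (n + 1)) key
  simp only [fourierCoeff_mulZ, add_sub_cancel_right, fourierCoeff_sub, fourierCoeff_smul,
    fourierCoeff_one] at h0
  rw [h0]
  rcases eq_or_ne (n + 1) 0 with h | h
  · simp [h]
  · rw [if_neg h, u.mem_hardy _ (by omega)]
    simp

theorem coe_ker (u : InnerFunction) :
    (ker u : L2) = one - conj (fourierCoeff u.toLp 0) • u.toLp := by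
  have h : one = (⟨_, one_sub_smul_toLp_mem_modelSpace u⟩ : modelSpace u) +
    conj (fourierCoeff u.toLp 0) • u.toLp := by simp
  rw [ker]
  conv_lhs => rw [h]
  rw [map_add, proj_of_mem, map_smul, proj_mulHardy u (toLp_mem_mulHardy u)]
  simp

/-- Only the coefficient of index `-1` of `C (z f)` can obstruct membership. It is the mean of `C
f`, that is, the conjugate of `⟪f, C k⟫`, and the multiple of `u` cancels it. -/
theorem mulZ_sub_mem (u : InnerFunction) (f : modelSpace u) :
    mulZ f - bil u f (ker u) • u.toLp ∈ modelSpace u := by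
  rw [mem_modelSpace_iff]
  refine ⟨hardy.sub_mem (mulZ_mem_hardy f.2.1) (hardy.smul_mem _ u.mem_hardy), fun n hn => ?_⟩
  set c := bil u f (ker u) with hc
  have key : mulZ (conjL2 u (mulZ f - c • u.toLp)) = conjL2 u f - conj c • one := by
    rw [conjL2_sub, conjL2_smul]
    refine Lp.ext ?_
    filter_upwards [mulZ_ae (conjL2 u (mulZ f) - conj c • conjL2 u u.toLp),
      Lp.coeFn_sub (conjL2 u (mulZ f)) (conj c • conjL2 u u.toLp),
      Lp.coeFn_smul (conj c) (conjL2 u u.toLp), mulZ_ae f,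
      conjL2_ae u (mulZ f), conjL2_ae u u.toLp, Lp.coeFn_sub (conjL2 u f) (conj c • one),
      Lp.coeFn_smul (conj c) one, conjL2_ae u f,
      one_ae, inner_mul_conj u] with x h1 h2 h3 h4 h5 h6 h7 h8 h9 h10 h11
    rw [h1, h2, Pi.sub_apply, h3, Pi.smul_apply, h5, h4, h6, h7, Pi.sub_apply, h8, Pi.smul_apply,
      h9, h10]
    simp only [map_mul, smul_eq_mul]
    linear_combination (u.toLp x * conj (zfun x) * conj ((f : L2) x)
      - conj c * u.toLp x * conj (u.toLp x)) * zfun_mul_conj x - conj c * h11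
  have h0 := congrArg (fun f : L2 => fourierCoeff f (n + 1)) key
  simp only [fourierCoeff_mulZ, add_sub_cancel_right, fourierCoeff_sub, fourierCoeff_smul,
    fourierCoeff_one] at h0
  rw [h0]
  rcases eq_or_ne (n + 1) 0 with h | h
  · rw [h, fourierCoeff_conjL2_zero, hc, bil_ker_right]
    simp
  · rw [if_neg h, (conjL2_mem u f.2).1 _ (by omega)]
    simp

theorem coe_compressedShift (u : InnerFunction) (f : modelSpace u) :
    (compressedShift u f : L2) = mulZ f - bil u f (ker u) • u.toLp := by
  have h : mulZ f = (⟨_, mulZ_sub_mem u f⟩ : modelSpace u) + bil u f (ker u) • u.toLp := by simp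
  change ((proj u (mulZ f) : modelSpace u) : L2) = _
  conv_lhs => rw [h]
  rw [map_add, proj_of_mem, map_smul, proj_mulHardy u (toLp_mem_mulHardy u)]
  simp

theorem compressedShift_eq_proj (u : InnerFunction) (f : modelSpace u) :
    compressedShift u f = proj u (mulZ f) := rfl

theorem compressedShift_smul (u : InnerFunction) (c : ℂ) (f : modelSpace u) :
    compressedShift u (c • f) = c • compressedShift u f := by
  simp only [compressedShift_eq_proj, Submodule.coe_smul, map_smul]

theorem bil_compressedShift (u : InnerFunction) (f g : modelSpace u) :
    bil u (compressedShift u f) g = bil u f (compressedShift u g) := by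
  rw [compressedShift_eq_proj, compressedShift_eq_proj, bil_proj, bil_proj_right, bil_mulZ_left]

theorem ker_ne_zero (u : InnerFunction) : ker u ≠ 0 := by
  intro h
  have h1 := coe_ker u
  rw [h] at h1
  set c := conj (fourierCoeff u.toLp 0)
  have h2 : ∀ᵐ x ∂circleMeasure, c * u.toLp x = 1 := by
    have h3 : c • u.toLp = one := (sub_eq_zero.1 h1.symm).symm
    filter_upwards [Lp.coeFn_smul c u.toLp, one_ae] with x h4 h5
    rw [← h5, ← h3, h4, Pi.smul_apply, smul_eq_mul]
  refine u.nonconstant c⁻¹ ?_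
  filter_upwards [h2] with x hx
  exact eq_inv_of_mul_eq_one_right hx

/-- The vectors `S_uⁿ k` span a dense subspace of the model space. -/
theorem eq_zero_of_bil_iterate (u : InnerFunction) (g : modelSpace u)
    (h : ∀ n : ℕ, bil u ((compressedShift u)^[n] (ker u) : modelSpace u) g = 0) : g = 0 := by
  have hswap : ∀ (n : ℕ) (f g : modelSpace u), bil u ((compressedShift u)^[n] f : modelSpace u) g =
      bil u f ((compressedShift u)^[n] g : modelSpace u) := by
    intro n
    induction n with
    | zero => intro f g; rfl
    | succ n ih =>
      intro f g
      rw [Function.iterate_succ_apply, ih, bil_compressedShift, Function.iterate_succ_apply']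
  have hb : ∀ n : ℕ, bil u ((compressedShift u)^[n] g : modelSpace u) (ker u) = 0 := by
    intro n
    rw [bil_comm, ← hswap, h]
  -- The correction term of the compressed shift vanishes along the whole orbit of `g`, so no
  -- projection is needed; `hb n` then says that the `n`th coefficient of `C g` is zero.
  have hz : ∀ n : ℕ, ((compressedShift u)^[n] g : L2) = (mulZ)^[n] (g : L2) := by
    intro n
    induction n with
    | zero => rfl
    | succ n ih =>
      rw [Function.iterate_succ_apply' (compressedShift u), coe_compressedShift, hb, zero_smul,
        sub_zero, ih]
      exact (Function.iterate_succ_apply' _ _ _).symm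
  have hC : ∀ (n : ℕ) (f : L2) (m : ℤ),
      fourierCoeff (conjL2 u (mulZ^[n] f)) m = fourierCoeff (conjL2 u f) (m + n) := by
    intro n
    induction n with
    | zero => intro f m; simp
    | succ n ih =>
      intro f m
      rw [Function.iterate_succ_apply, ih, fourierCoeff_conjL2_mulZ]
      congr 1
      push_cast
      ring
  have hzero : conjL2 u g = 0 := by
    refine eq_zero_of_fourierCoeff fun n => ?_
    rcases lt_or_ge n 0 with hn | hn
    · exact (conjL2_mem u g.2).1 n hn
    · lift n to ℕ using hn
      have h1 := hb n
      rw [bil_ker_right, hz, ← map_eq_zero (starRingEnd ℂ), ← fourierCoeff_conjL2_zero, hC,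
        zero_add] at h1
      exact h1
  have h2 := conjL2_conjL2 u (g : L2)
  rw [hzero] at h2
  have h3 : conjL2 u (0 : L2) = 0 := by
    have := conjL2_smul u 0 0
    simpa using this
  rw [h3] at h2
  exact Subtype.ext h2.symm

/-! ### Bounded functions in the model space -/

theorem memLp_ker (u : InnerFunction) : MemLp (ker u : L2) ⊤ circleMeasure := by
  rw [coe_ker]
  refine MemLp.ae_eq (Lp.coeFn_sub _ _).symm (MemLp.sub ?_ ?_)
  · exact MemLp.ae_eq (Lp.coeFn_const 2 circleMeasure (1 : ℂ)).symm (memLp_const 1)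
  · exact MemLp.ae_eq (Lp.coeFn_smul _ _).symm ((memLp_inner u).const_smul _)

theorem memLp_compressedShift (u : InnerFunction) {f : modelSpace u}
    (hf : MemLp (f : L2) ⊤ circleMeasure) :
    MemLp (compressedShift u f : L2) ⊤ circleMeasure := by
  rw [coe_compressedShift]
  refine MemLp.ae_eq (Lp.coeFn_sub _ _).symm (MemLp.sub ?_ ?_)
  · exact MemLp.ae_eq (f := fun x => zfun x * (f : L2) x)
      ((mulZ_ae f).mono fun x h => h.symm) (hf.mul' memLp_zfun)
  · exact MemLp.ae_eq (Lp.coeFn_smul _ _).symm ((memLp_inner u).const_smul _)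

theorem memLp_iterate (u : InnerFunction) (n : ℕ) :
    MemLp (((compressedShift u)^[n] (ker u) : modelSpace u) : L2) ⊤ circleMeasure := by
  induction n with
  | zero => exact memLp_ker u
  | succ n ih =>
    rw [Function.iterate_succ_apply']
    exact memLp_compressedShift u ih

/-- Vectors that agree against all bounded functions are equal. -/
theorem eq_of_bil_bounded (u : InnerFunction) {f g : modelSpace u}
    (h : ∀ k : modelSpace u, MemLp (k : L2) ⊤ circleMeasure → bil u k f = bil u k g) : f = g := by
  refine sub_eq_zero.1 (eq_zero_of_bil_iterate u _ fun n => ?_)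
  rw [Submodule.coe_sub, bil_sub_right, h _ (memLp_iterate u n), sub_self]

theorem bil_mulBdd (u : InnerFunction) (Φ f g : L2) (hf : MemLp f ⊤ circleMeasure)
    (hg : MemLp g ⊤ circleMeasure) : bil u (mulBdd Φ f hf) g = bil u f (mulBdd Φ g hg) := by
  rw [bil_eq_integral, bil_eq_integral]
  refine integral_congr_ae ?_
  filter_upwards [mulBdd_ae Φ f hf, mulBdd_ae Φ g hg] with x h1 h2
  rw [h1, h2]; ring

theorem bil_mulBdd_toLp (u : InnerFunction) (Φ f : L2) (hf : MemLp f ⊤ circleMeasure) :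
    bil u (mulBdd Φ f hf) u.toLp = bil u (mulU u Φ) f := by
  rw [bil_eq_integral, bil_eq_integral]
  refine integral_congr_ae ?_
  filter_upwards [mulBdd_ae Φ f hf, mulU_ae u Φ] with x h1 h2
  rw [h1, h2]; ring

/-- The operator `f ↦ ⟪f, C b⟫ a - ⟪f, C a⟫ b`. -/
noncomputable def wedge (u : InnerFunction) (a b f : modelSpace u) : modelSpace u :=
  bil u f b • a - bil u f a • b

/-- The commutator of a truncated Toeplitz operator and the compressed shift. -/
theorem proj_mulBdd_compressedShift (u : InnerFunction) (Φ : L2) (f : modelSpace u)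
    (hf : MemLp (f : L2) ⊤ circleMeasure) :
    proj u (mulBdd Φ (compressedShift u f : L2) (memLp_compressedShift u hf)) -
      compressedShift u (proj u (mulBdd Φ (f : L2) hf)) =
        wedge u (ker u) (proj u (mulU u Φ)) f := by
  refine modelSpace_ext u fun g => ?_
  have h1 : mulBdd Φ (compressedShift u f : L2) (memLp_compressedShift u hf) =
      mulZ (mulBdd Φ (f : L2) hf) - bil u f (ker u) • mulU u Φ := by
    set c := bil u f (ker u) with hc
    refine Lp.ext ?_
    filter_upwards [mulBdd_ae Φ (compressedShift u f : L2) (memLp_compressedShift u hf),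
      mulBdd_ae Φ (f : L2) hf, mulZ_ae (mulBdd Φ (f : L2) hf), mulU_ae u Φ,
      Lp.coeFn_sub (mulZ (mulBdd Φ (f : L2) hf)) (c • mulU u Φ), Lp.coeFn_smul c (mulU u Φ),
      Lp.coeFn_sub (mulZ (f : L2)) (c • u.toLp), Lp.coeFn_smul c u.toLp, mulZ_ae (f : L2)]
      with x h1 h2 h3 h4 h5 h6 h7 h8 h9
    rw [h1, coe_compressedShift, h7, h5, Pi.sub_apply, Pi.sub_apply, h3, h2, h6, h8, Pi.smul_apply,
      Pi.smul_apply, h4, h9, smul_eq_mul, smul_eq_mul]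
    ring
  rw [wedge, Submodule.coe_sub, Submodule.coe_sub, bil_sub_left, bil_sub_left, bil_compressedShift,
    bil_proj, bil_proj, h1, coe_compressedShift, bil_sub_left, bil_sub_right, bil_mulZ_left,
    Submodule.coe_smul, Submodule.coe_smul]
  simp only [bil_smul_left, bil_smul_right, bil_mulBdd_toLp, bil_proj, bil_proj_right]
  rw [bil_comm u (ker u), bil_comm u f (mulU u Φ)]
  ring

theorem proj_mulBdd_ker (u : InnerFunction) (Φ : L2) :
    proj u (mulBdd Φ (ker u : L2) (memLp_ker u)) =
      proj u Φ - conj (fourierCoeff u.toLp 0) • proj u (mulU u Φ) := by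
  rw [← map_smul, ← map_sub]
  congr 1
  set c := conj (fourierCoeff u.toLp 0) with hc
  refine Lp.ext ?_
  filter_upwards [mulBdd_ae Φ (ker u : L2) (memLp_ker u), Lp.coeFn_sub Φ (c • mulU u Φ),
    Lp.coeFn_smul c (mulU u Φ), mulU_ae u Φ, Lp.coeFn_sub one (c • u.toLp),
    Lp.coeFn_smul c u.toLp, one_ae] with x h1 h2 h3 h4 h5 h6 h7
  rw [h1, h2, coe_ker, h5, Pi.sub_apply, Pi.sub_apply, h3, h6, Pi.smul_apply, Pi.smul_apply, h4, h7,
    smul_eq_mul, smul_eq_mul]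
  ring

/-! ### Complex symmetric operators and their commutators with the compressed shift -/

/-- `A` is symmetric for the bilinear form, i.e. `C A C = A*`. -/
def IsSymm (u : InnerFunction) (A : modelSpace u →L[ℂ] modelSpace u) : Prop :=
  ∀ f g : modelSpace u, bil u (A f) g = bil u f (A g)

/-- The commutator of `A` and the compressed shift is the operator `wedge` of the kernel at the
origin and `w`. -/
def HasCommutator (u : InnerFunction) (A : modelSpace u →L[ℂ] modelSpace u) (w : modelSpace u) :
    Prop :=
  ∀ f, A (compressedShift u f) - compressedShift u (A f) = wedge u (ker u) w f

/-- The transpose is `C A* C`. It allows identities known only on bounded functions to be extended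
by duality. -/
theorem exists_transpose (u : InnerFunction) (A : modelSpace u →L[ℂ] modelSpace u)
    (g : modelSpace u) : ∃ g' : modelSpace u, ∀ f : modelSpace u, bil u (A f) g = bil u f g' := by
  refine ⟨conjModel u (ContinuousLinearMap.adjoint A (conjModel u g)), fun f => ?_⟩
  have h := ContinuousLinearMap.adjoint_inner_left A f (conjModel u g)
  simp only [bil, conjModel, conjL2_conjL2]
  exact h.symm

section symm

variable {u : InnerFunction} {A : modelSpace u →L[ℂ] modelSpace u} {Φ : L2} {w : modelSpace u}

theorem HasSymbol.isSymm (h : HasSymbol u A Φ) : IsSymm u A := by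
  -- The symbol acts by a formula only on bounded functions, so the boundedness assumption is
  -- removed from one argument at a time.
  have h1 : ∀ f g : modelSpace u, MemLp (f : L2) ⊤ circleMeasure →
      bil u (A g) f = bil u g (A f) := by
    intro f g hf
    obtain ⟨f', hf'⟩ := exists_transpose u A f
    rw [hf', eq_of_bil_bounded u (f := f') (g := A f)]
    intro k hk
    rw [← hf', h k hk, h f hf, bil_proj, bil_proj_right, bil_mulBdd]
  intro f g
  obtain ⟨g', hg'⟩ := exists_transpose u A g
  rw [hg', eq_of_bil_bounded u (f := g') (g := A g)]
  intro k hk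
  rw [← hg', bil_comm, ← h1 k g hk, bil_comm]

theorem bil_wedge (a b f g : modelSpace u) :
    bil u (wedge u a b f) g = - bil u f (wedge u a b g) := by
  simp only [wedge, Submodule.coe_sub, Submodule.coe_smul, bil_sub_left, bil_sub_right,
    bil_smul_left, bil_smul_right]
  rw [bil_comm u a g, bil_comm u b g]
  ring

theorem HasSymbol.hasCommutator (h : HasSymbol u A Φ) : HasCommutator u A (proj u (mulU u Φ)) := by
  intro f
  refine eq_of_bil_bounded u fun k hk => ?_
  have h1 : A (compressedShift u k) - compressedShift u (A k) =
      wedge u (ker u) (proj u (mulU u Φ)) k := by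
    rw [h k hk, h _ (memLp_compressedShift u hk), proj_mulBdd_compressedShift]
  have h2 := bil_wedge (ker u) (proj u (mulU u Φ)) k f
  -- The commutator of two self-transpose operators is antisymmetric, as is `wedge`; this moves the
  -- identity from the bounded `k` to an arbitrary `f`.
  rw [← h1, Submodule.coe_sub, bil_sub_left, bil_compressedShift, h.isSymm, h.isSymm,
    bil_compressedShift] at h2
  rw [Submodule.coe_sub, bil_sub_right]
  linear_combination -h2

theorem HasSymbol.apply_ker (h : HasSymbol u A Φ) :
    A (ker u) = proj u Φ - conj (fourierCoeff u.toLp 0) • proj u (mulU u Φ) := by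
  rw [h _ (memLp_ker u), proj_mulBdd_ker]

/-- Symbols are characterized by the commutator with the shift and the action on the kernel. -/
theorem hasSymbol_of_hasCommutator (hA : IsSymm u A) (hw : HasCommutator u A (proj u (mulU u Φ)))
    (hk : A (ker u) = proj u Φ - conj (fourierCoeff u.toLp 0) • proj u (mulU u Φ)) :
    HasSymbol u A Φ := by
  -- Equal commutators and equal values at the kernel give agreement on its whole orbit under the
  -- shift.
  have h1 : ∀ n : ℕ, A ((compressedShift u)^[n] (ker u)) =
      proj u (mulBdd Φ (((compressedShift u)^[n] (ker u) : modelSpace u) : L2)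
        (memLp_iterate u n)) := by
    intro n
    induction n with
    | zero => exact hk.trans (proj_mulBdd_ker u Φ).symm
    | succ n ih =>
      have h2 := hw ((compressedShift u)^[n] (ker u))
      rw [← proj_mulBdd_compressedShift u Φ _ (memLp_iterate u n), ih, sub_left_inj] at h2
      simp only [Function.iterate_succ_apply']
      exact h2
  intro f hf
  refine sub_eq_zero.1 (eq_zero_of_bil_iterate u _ fun n => ?_)
  rw [Submodule.coe_sub, bil_sub_right, ← hA, h1, bil_proj, bil_proj_right, bil_mulBdd _ _ _ _ _ hf,
    sub_self]

/-! ### Symbols with prescribed projections -/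

theorem proj_star_of_mem_hardy (u : InnerFunction) {h : L2} (hh : h ∈ hardy) :
    proj u (star h) = conj (fourierCoeff h 0) • ker u := by
  refine ext_inner_left ℂ fun g => ?_
  rw [Submodule.coe_inner, Submodule.coe_inner, inner_proj, Submodule.coe_smul, inner_smul_right,
    ker, inner_proj, ← inner_conj_symm, inner_star_of_mem_hardy hh g.2.1,
    ← inner_conj_symm (g : L2) one, one_eq_fourierBasis, ← fourierCoeff_eq_inner, map_mul]

theorem proj_mulU_of_mem_hardy (u : InnerFunction) {h : L2} (hh : h ∈ hardy) :
    proj u (mulU u h) = 0 := proj_mulHardy u (mulU_mem_mulHardy u hh)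

/-- Since `S_u C g = z C g - c u` and `u * conj (z C g) = g`, the product is `g` minus a constant.
This is why `conj (S_u C φ)` appears in the definition of type: it realizes a prescribed commutator
vector modulo the kernel. -/
theorem exists_proj_mulU_star (u : InnerFunction) (g : modelSpace u) :
    ∃ r : ℂ, proj u (mulU u (star (compressedShift u (conjModel u g) : L2))) = g + r • ker u := by
  refine ⟨-conj (bil u (conjModel u g) (ker u)), ?_⟩
  set c := bil u (conjModel u g) (ker u) with hc
  have : mulU u (star (compressedShift u (conjModel u g) : L2)) = (g : L2) - conj c • one := by
    rw [coe_compressedShift, ← hc]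
    refine Lp.ext ?_
    filter_upwards [mulU_ae u (star (mulZ (conjModel u g : L2) - c • u.toLp)),
      star_ae (mulZ (conjModel u g : L2) - c • u.toLp),
      Lp.coeFn_sub (mulZ (conjModel u g : L2)) (c • u.toLp), Lp.coeFn_smul c u.toLp,
      mulZ_ae (conjModel u g : L2), conjL2_ae u g, Lp.coeFn_sub (g : L2) (conj c • one),
      Lp.coeFn_smul (conj c) one, one_ae, inner_mul_conj u] with x h1 h2 h3 h4 h5 h6 h7 h8 h9 h10
    rw [h1, h2, h3, Pi.sub_apply, h4, h5, Pi.smul_apply, h7, Pi.sub_apply, h8, Pi.smul_apply, h9]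
    simp only [conjModel]
    rw [h6]
    simp only [map_mul, map_sub, smul_eq_mul, Complex.conj_conj]
    linear_combination ((g : L2) x * zfun x * conj (zfun x) - conj c) * h10 +
      (g : L2) x * zfun_mul_conj x
  rw [this, map_sub, map_smul, proj_of_mem, neg_smul, ← sub_eq_add_neg]
  rfl

theorem wedge_add_smul (a b f : modelSpace u) (r : ℂ) :
    wedge u a (b + r • a) f = wedge u a b f := by
  simp only [wedge, Submodule.coe_add, Submodule.coe_smul, bil_add_right, bil_smul_right]
  module

/-- The analytic part `φ` adjusts `P_u Φ` and the coanalytic part from `ψ` adjusts `P_u (u Φ)`, each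
modulo the kernel; the constant absorbs the remaining multiple of the kernel in the value of `A`
there. -/
theorem exists_hasSymbol (hA : IsSymm u A) (hw : HasCommutator u A w) (φ ψ : modelSpace u)
    (s t : ℂ) (hφ : φ = A (ker u) + conj (fourierCoeff u.toLp 0) • w + s • ker u)
    (hψ : ψ = w + t • ker u) :
    ∃ c : ℂ, HasSymbol u A ((φ : L2) + star (compressedShift u (conjModel u ψ) : L2) +
      Lp.const 2 circleMeasure c) := by
  obtain ⟨r, hr⟩ := exists_proj_mulU_star u ψ
  set h := compressedShift u (conjModel u ψ)
  set v := conj (fourierCoeff u.toLp 0)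
  refine ⟨v * (t + r) - s - conj (fourierCoeff (h : L2) 0), ?_⟩
  set c := v * (t + r) - s - conj (fourierCoeff (h : L2) 0) with hc
  have h1 : proj u ((φ : L2) + star (h : L2) + Lp.const 2 circleMeasure c) =
      φ + conj (fourierCoeff (h : L2) 0) • ker u + c • ker u := by
    rw [map_add, map_add, proj_of_mem, proj_star_of_mem_hardy u h.2.1, const_eq_smul_one, map_smul]
    rfl
  have h2 : proj u (mulU u ((φ : L2) + star (h : L2) + Lp.const 2 circleMeasure c)) =
      w + (t + r) • ker u := by
    rw [map_add, map_add, map_add, map_add, proj_mulU_of_mem_hardy u φ.2.1, const_eq_smul_one,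
      proj_mulU_of_mem_hardy u (hardy.smul_mem c one_mem_hardy), hr, hψ]
    module
  refine hasSymbol_of_hasCommutator hA ?_ ?_
  · intro f
    rw [h2, wedge_add_smul]
    exact hw f
  · rw [h1, h2, hφ, hc]
    module

end symm

/-! ### Types in terms of commutators -/

/-- A linear relation modulo the kernel at the origin between the image of that kernel and the
vector that describes the commutator with the compressed shift. -/
def HasRelation (u : InnerFunction) (A : modelSpace u →L[ℂ] modelSpace u) (a b : ℂ) : Prop :=
  ∃ (w : modelSpace u) (d : ℂ), HasCommutator u A w ∧ a • A (ker u) + b • w = d • ker u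

variable {u : InnerFunction} {A : modelSpace u →L[ℂ] modelSpace u}

theorem IsTTO.isSymm (h : IsTTO u A) : IsSymm u A := h.elim fun _ h => h.isSymm

theorem HasRelation.smul {a b : ℂ} (h : HasRelation u A a b) (t : ℂ) :
    HasRelation u A (t * a) (t * b) := by
  obtain ⟨w, d, hw, hd⟩ := h
  refine ⟨w, t * d, hw, ?_⟩
  rw [mul_smul, mul_smul, ← smul_add, hd, mul_smul]

theorem IsOfType.isTTO {α : OnePoint ℂ} (h : IsOfType u A α) : IsTTO u A := by
  match α, h with
  | OnePoint.infty, ⟨Φ, _, h⟩ => exact ⟨Φ, h⟩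
  | OnePoint.some α, ⟨φ, c, h⟩ => exact ⟨_, h⟩

theorem star_compressedShift_conjModel_smul (φ : modelSpace u) (α : ℂ) :
    star (compressedShift u (conjModel u (α • φ)) : L2) =
      α • star (compressedShift u (conjModel u φ) : L2) := by
  have h : conjModel u (α • φ) = conj α • conjModel u φ := Subtype.ext (conjL2_smul u α φ)
  rw [h, compressedShift_smul, Submodule.coe_smul]
  set g : L2 := (compressedShift u (conjModel u φ) : L2)
  refine Lp.ext ?_
  filter_upwards [star_ae (conj α • g), star_ae g, Lp.coeFn_smul (conj α) g,
    Lp.coeFn_smul α (star g)] with x h1 h2 h3 h4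
  rw [h1, h3, h4, Pi.smul_apply, Pi.smul_apply, h2, smul_eq_mul, smul_eq_mul, map_mul,
    Complex.conj_conj]

theorem isOfType_some_iff (hA : IsSymm u A) (α : ℂ) :
    IsOfType u A (OnePoint.some α) ↔
      HasRelation u A α (α * conj (fourierCoeff u.toLp 0) - 1) := by
  constructor
  · rintro ⟨φ, c, h⟩
    obtain ⟨r, hr⟩ := exists_proj_mulU_star u φ
    have h0 := h.hasCommutator
    have h1 := h.apply_ker
    have h2 := proj_star_of_mem_hardy u (compressedShift u (conjModel u φ)).2.1
    set g := compressedShift u (conjModel u φ)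
    set v := conj (fourierCoeff u.toLp 0)
    refine ⟨_, α * (α * conj (fourierCoeff (g : L2) 0) + c) - α * r, h0, ?_⟩
    rw [h1]
    rw [const_eq_smul_one c]
    simp only [map_add, map_smul, proj_mulU_of_mem_hardy u φ.2.1,
      proj_mulU_of_mem_hardy u one_mem_hardy, hr, h2, proj_of_mem]
    rw [← ker]
    module
  · rintro ⟨w, d, hw, hd⟩
    set v := conj (fourierCoeff u.toLp 0)
    -- With `φ = A k + v w`, the relation says exactly that `α φ = w + d k`, so `ψ = α φ` is
    -- admissible.
    obtain ⟨c, hc⟩ := exists_hasSymbol hA hw (A (ker u) + v • w)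
      (α • (A (ker u) + v • w)) 0 d (by rw [zero_smul, add_zero]) (by rw [← hd]; module)
    rw [star_compressedShift_conjModel_smul] at hc
    exact ⟨_, c, hc⟩

theorem star_L2_add (f g : L2) : (star (f + g) : L2) = star f + star g := by
  refine Lp.ext ?_
  filter_upwards [star_ae (f + g), star_ae f, star_ae g, Lp.coeFn_add f g,
    Lp.coeFn_add (star f) (star g)] with x h1 h2 h3 h4 h5
  rw [h1, h4, h5, Pi.add_apply, Pi.add_apply, h2, h3, map_add]

theorem isOfType_infty_iff (hA : IsSymm u A) :
    IsOfType u A OnePoint.infty ↔ HasRelation u A 1 (conj (fourierCoeff u.toLp 0)) := by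
  constructor
  · rintro ⟨Φ, hΦ, h⟩
    refine ⟨_, conj (fourierCoeff (star Φ : L2) 0), h.hasCommutator, ?_⟩
    rw [h.apply_ker, one_smul, sub_add_cancel, ← proj_star_of_mem_hardy u hΦ, star_star]
  · rintro ⟨w, d, hw, hd⟩
    obtain ⟨c, hc⟩ := exists_hasSymbol hA hw 0 w (-d) 0
      (by rw [neg_smul, ← hd]; module) (by module)
    refine ⟨_, ?_, hc⟩
    have h1 : star (Lp.const 2 circleMeasure c : L2) = conj c • one := by
      refine Lp.ext ?_
      filter_upwards [star_ae (Lp.const 2 circleMeasure c), Lp.coeFn_const 2 circleMeasure c,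
        Lp.coeFn_smul (conj c) one, one_ae] with x h1 h2 h3 h4
      rw [h1, h2, h3, Pi.smul_apply, h4]
      simp
    rw [Submodule.coe_zero, zero_add, star_L2_add, star_star, h1]
    exact hardy.add_mem (compressedShift u (conjModel u w)).2.1 (hardy.smul_mem _ one_mem_hardy)

theorem exists_isOfType_iff (hA : IsSymm u A) :
    (∃ α, IsOfType u A α) ↔ ∃ a b : ℂ, (a ≠ 0 ∨ b ≠ 0) ∧ HasRelation u A a b := by
  constructor
  · rintro ⟨α | α, h⟩
    · exact ⟨_, _, Or.inl one_ne_zero, (isOfType_infty_iff hA).1 h⟩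
    · refine ⟨_, _, ?_, (isOfType_some_iff hA α).1 h⟩
      rcases eq_or_ne α 0 with rfl | h0
      · right; simp
      · exact Or.inl h0
  · rintro ⟨a, b, hab, h⟩
    set v := conj (fourierCoeff u.toLp 0) with hv
    -- Rescaling to `(α, α v - 1)` forces `α = a / (a v - b)`; a vanishing denominator is the point
    -- at infinity.
    rcases eq_or_ne (a * v - b) 0 with h0 | h0
    · have hb : b = a * v := (sub_eq_zero.1 h0).symm
      have ha : a ≠ 0 := by
        rintro rfl
        simp [hb] at hab
      refine ⟨OnePoint.infty, (isOfType_infty_iff hA).2 ?_⟩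
      have := h.smul a⁻¹
      rwa [hb, inv_mul_cancel₀ ha, inv_mul_cancel_left₀ ha] at this
    · refine ⟨OnePoint.some (a / (a * v - b)), (isOfType_some_iff hA _).2 ?_⟩
      convert h.smul (a * v - b)⁻¹ using 1
      · field_simp
      · rw [← hv]
        field_simp
        ring

/-! ### The inverse of a truncated Toeplitz operator -/

section inverse

variable (A : (modelSpace u →L[ℂ] modelSpace u)ˣ)

theorem inv_apply_apply (f : modelSpace u) :
    (↑A⁻¹ : modelSpace u →L[ℂ] modelSpace u) ((A : modelSpace u →L[ℂ] modelSpace u) f) = f :=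
  DFunLike.congr_fun A.inv_mul f

theorem apply_inv_apply (f : modelSpace u) :
    (A : modelSpace u →L[ℂ] modelSpace u) ((↑A⁻¹ : modelSpace u →L[ℂ] modelSpace u) f) = f :=
  DFunLike.congr_fun A.mul_inv f

variable {A}

theorem IsSymm.inv (hA : IsSymm u A) : IsSymm u (↑A⁻¹ : modelSpace u →L[ℂ] modelSpace u) := by
  intro f g
  conv_lhs => rw [← apply_inv_apply A g]
  rw [← hA, apply_inv_apply]

theorem commutator_inv (hA : IsSymm u A) {w : modelSpace u} (hw : HasCommutator u A w)
    (f : modelSpace u) :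
    (↑A⁻¹ : modelSpace u →L[ℂ] modelSpace u) (compressedShift u f) -
      compressedShift u ((↑A⁻¹ : modelSpace u →L[ℂ] modelSpace u) f) =
        wedge u ((↑A⁻¹ : modelSpace u →L[ℂ] modelSpace u) w)
          ((↑A⁻¹ : modelSpace u →L[ℂ] modelSpace u) (ker u)) f := by
  have hB := hA.inv
  set B : modelSpace u →L[ℂ] modelSpace u := ↑A⁻¹ with hBdef
  have h := congrArg B (hw (B f))
  rw [map_sub, inv_apply_apply, apply_inv_apply, wedge, map_sub, map_smul, map_smul, hB, hB] at h
  rw [wedge, ← neg_sub, h, neg_sub]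

theorem HasRelation.inv (hA : IsSymm u A) {a b : ℂ} (hab : a ≠ 0 ∨ b ≠ 0)
    (h : HasRelation u A a b) :
    HasRelation u (↑A⁻¹ : modelSpace u →L[ℂ] modelSpace u) a b := by
  obtain ⟨w, d, hw, hd⟩ := h
  have hc := commutator_inv hA hw
  have hd' := congrArg (↑A⁻¹ : modelSpace u →L[ℂ] modelSpace u) hd
  rw [map_add, map_smul, map_smul, map_smul, inv_apply_apply] at hd'
  set B : modelSpace u →L[ℂ] modelSpace u := ↑A⁻¹ with hBdef
  rcases eq_or_ne b 0 with rfl | hb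
  · have ha : a ≠ 0 := hab.resolve_right (· rfl)
    rw [zero_smul, add_zero] at hd'
    -- Here `a • k = d • A⁻¹ k` with `a` and `k` nonzero, so the kernel is an eigenvector of the
    -- inverse.
    have hd0 : d ≠ 0 := by
      rintro rfl
      rw [zero_smul] at hd'
      exact (smul_ne_zero ha (ker_ne_zero u)) hd'
    have hk : B (ker u) = (a / d) • ker u := by
      rw [div_eq_inv_mul, mul_smul, hd', smul_smul, inv_mul_cancel₀ hd0, one_smul]
    refine ⟨-(a / d) • B w, a * (a / d), fun f => ?_, ?_⟩
    · rw [hc f, hk]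
      simp only [wedge, Submodule.coe_smul, bil_smul_right]
      module
    · rw [hk]
      module
  -- The `B k` component of `B w` drops out of `B w ∧ B k`, leaving `k ∧ (-(a / b) B k)`.
  · have hw' : B w = (d / b) • B (ker u) - (a / b) • ker u := by
      have : b • B w = d • B (ker u) - a • ker u := by rw [← hd']; abel
      rw [div_eq_inv_mul, div_eq_inv_mul, mul_smul, mul_smul, ← smul_sub, ← this, smul_smul,
        inv_mul_cancel₀ hb, one_smul]
    refine ⟨-(a / b) • B (ker u), 0, fun f => ?_, ?_⟩
    · rw [hc f, hw']
      simp only [wedge, Submodule.coe_smul, Submodule.coe_sub, bil_smul_right, bil_sub_right]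
      module
    · rw [smul_smul, mul_neg, mul_div_cancel₀ _ hb]
      module

theorem exists_bil_ker_ne_zero (u : InnerFunction) : ∃ f : modelSpace u, bil u f (ker u) ≠ 0 := by
  by_contra! h
  refine ker_ne_zero u (modelSpace_ext u fun f => ?_)
  rw [bil_comm, h, Submodule.coe_zero, ← zero_smul ℂ (0 : L2), bil_smul_left, zero_mul]

theorem eq_smul_ker_of_wedge_eq_zero {w : modelSpace u} (h : ∀ f, wedge u (ker u) w f = 0) :
    ∃ c : ℂ, w = c • ker u := by
  obtain ⟨f, hf⟩ := exists_bil_ker_ne_zero u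
  refine ⟨(bil u f (ker u))⁻¹ * bil u f w, ?_⟩
  rw [mul_smul, sub_eq_zero.1 (h f), smul_smul, inv_mul_cancel₀ hf, one_smul]

/-- A functional vanishing on the null space of another is a multiple of it, and the form is
nondegenerate. -/
theorem exists_bil_ker_eq_zero {y : modelSpace u} (hy : ¬ ∃ c : ℂ, y = c • ker u) :
    ∃ f : modelSpace u, bil u f (ker u) = 0 ∧ bil u f y ≠ 0 := by
  by_contra! h
  obtain ⟨e, he⟩ := exists_bil_ker_ne_zero u
  refine hy ⟨bil u e y / bil u e (ker u), modelSpace_ext u fun f => ?_⟩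
  have h1 := h (f - (bil u f (ker u) / bil u e (ker u)) • e) (by
    rw [Submodule.coe_sub, Submodule.coe_smul, bil_sub_left, bil_smul_left]
    field_simp
    ring)
  rw [Submodule.coe_sub, Submodule.coe_smul, bil_sub_left, bil_smul_left] at h1
  rw [Submodule.coe_smul, bil_smul_left, bil_comm, bil_comm u (ker u), sub_eq_zero.1 h1]
  ring

theorem exists_hasRelation (hA : IsSymm u A) {w y : modelSpace u} (hw : HasCommutator u A w)
    (hy : HasCommutator u (↑A⁻¹ : modelSpace u →L[ℂ] modelSpace u) y) :
    ∃ a b : ℂ, (a ≠ 0 ∨ b ≠ 0) ∧ HasRelation u A a b := by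
  have hc := commutator_inv hA hw
  -- If `y` is a multiple of the kernel, the inverse commutes with the shift; so does `A`, and `w`
  -- is a multiple of the kernel too.
  by_cases h : ∃ c : ℂ, y = c • ker u
  · obtain ⟨c, rfl⟩ := h
    obtain ⟨d, hd⟩ := eq_smul_ker_of_wedge_eq_zero (w := w) fun f => by
      have h1 := congrArg (A : modelSpace u →L[ℂ] modelSpace u)
        (hy ((A : modelSpace u →L[ℂ] modelSpace u) f))
      have h2 : wedge u (ker u) (c • ker u) ((A : modelSpace u →L[ℂ] modelSpace u) f) = 0 := by
        simp only [wedge, Submodule.coe_smul, bil_smul_right]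
        module
      rw [h2, map_zero, map_sub, inv_apply_apply, apply_inv_apply] at h1
      rw [← hw f, ← neg_sub, h1, neg_zero]
    refine ⟨0, 1, Or.inr one_ne_zero, w, d, hw, ?_⟩
    rw [hd]
    module
  -- At such an `f` the side `k ∧ y` reduces to a nonzero multiple of `k`; applying `A` to both
  -- sides expresses `A k` through `w` and `k`.
  · obtain ⟨f, hf, hfy⟩ := exists_bil_ker_eq_zero h
    have h1 := congrArg (A : modelSpace u →L[ℂ] modelSpace u) ((hy f).symm.trans (hc f))
    simp only [wedge, hf, zero_smul, sub_zero, map_sub, map_smul, apply_inv_apply] at h1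
    refine ⟨bil u f y, -bil u f ((↑A⁻¹ : modelSpace u →L[ℂ] modelSpace u) (ker u)), Or.inl hfy,
      w, -bil u f ((↑A⁻¹ : modelSpace u →L[ℂ] modelSpace u) w), hw, ?_⟩
    rw [h1]
    module

theorem IsOfType.inv (hA : IsSymm u A) {α : OnePoint ℂ} (h : IsOfType u A α) :
    IsOfType u (↑A⁻¹ : modelSpace u →L[ℂ] modelSpace u) α := by
  match α, h with
  | OnePoint.infty, h =>
    exact (isOfType_infty_iff hA.inv).2
      (((isOfType_infty_iff hA).1 h).inv hA (Or.inl one_ne_zero))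
  | OnePoint.some α, h =>
    refine (isOfType_some_iff hA.inv α).2 (((isOfType_some_iff hA α).1 h).inv hA ?_)
    rcases eq_or_ne α 0 with rfl | h0
    · right; simp
    · exact Or.inl h0

end inverse

end TTO

end

theorem mainTheorem4 (u : TTO.InnerFunction)
    (A : (TTO.modelSpace u →L[ℂ] TTO.modelSpace u)ˣ)
    (hA : TTO.IsTTO u (A : TTO.modelSpace u →L[ℂ] TTO.modelSpace u)) :
    (TTO.IsTTO u (↑A⁻¹ : TTO.modelSpace u →L[ℂ] TTO.modelSpace u) ↔
      ∃ α : OnePoint ℂ, TTO.IsOfType u (A : TTO.modelSpace u →L[ℂ] TTO.modelSpace u) α) ∧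
    (TTO.IsTTO u (↑A⁻¹ : TTO.modelSpace u →L[ℂ] TTO.modelSpace u) →
      ∀ α : OnePoint ℂ,
        TTO.IsOfType u (A : TTO.modelSpace u →L[ℂ] TTO.modelSpace u) α ↔
          TTO.IsOfType u (↑A⁻¹ : TTO.modelSpace u →L[ℂ] TTO.modelSpace u) α) := by
  have hS := hA.isSymm
  refine ⟨⟨fun ⟨Ψ, hΨ⟩ => ?_, fun ⟨α, h⟩ => (h.inv hS).isTTO⟩, fun _ α => ⟨fun h => h.inv hS,
    fun h => ?_⟩⟩
  · obtain ⟨Φ, hΦ⟩ := hA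
    exact (TTO.exists_isOfType_iff hS).2
      (TTO.exists_hasRelation hS hΦ.hasCommutator hΨ.hasCommutator)
  · have := h.inv hS.inv
    rwa [inv_inv] at this
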